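/- Let $N\ge 3$ and let $V:(0,\infty)\to[0,\infty)$ and $K:(0,\infty)\to(0,\infty)$ be continuous functions such that, for some $C>0$, $V(r)\le C/r^2$ for all $r\in(0,1)$. Let $f:\mathbb{R}\to\mathbb{R}$ be the unique solution of $f'(t)=1/\sqrt{1+2f(t)^2}$ on $\mathbb{R}$, $f(0)=0$. Let $D^{1,2}_r(\mathbb{R}^N)$ be the closure of the space $C^\infty_{\mathrm{c},r}(\mathbb{R}^N)$ of radial smooth compactly supported real functions with respect to the norm $\|u\|_{1,2}=\left(\int_{\mathbb{R}^N}|\nabla u|^2\,dx\right)^{1/2}$ (realized, by the Sobolev inequality, as a space of functions in $L^{2N/(N-2)}(\mathbb{R}^N)$ with weak gradient in $L^2$). Let $$E=\Big\{u\in D^{1,2}_r(\mathbb{R}^N) : \int_{\mathbb{R}^N}V(|x|)f(u)^2\,dx<\infty\Big\},\qquad \|u\|=\|u\|_{1,2}+\inf_{k>0}\frac1k\Big[1+\int_{\mathbb{R}^N}V(|x|)f(ku)^2\,dx\Big].$$ For $1<q<\infty$ let $L^q_K=L^q(\mathbb{R}^N,K(|x|)\,dx)$, and for $q_1,q_2>1$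 let $L^{q_1}_K+L^{q_2}_K=\{u_1+u_2: u_i\in L^{q_i}_K\}$ carry the norm $$\inf_{u_1+u_2=u}\max\big\{\|u_1\|_{L^{q_1}_K},\|u_2\|_{L^{q_2}_K}\big\}.$$ For $R>0$, $q>1$ and $B_R=\{x\in\mathbb{R}^N:|x|<R\}$ define, with values in $[0,\infty]$, $$\mathcal S_0(q,R)=\sup_{u\in E,\ \|u\|=1}\int_{B_R}K(|x|)|u|^q\,dx,\qquad \mathcal S_\infty(q,R)=\sup_{u\in E,\ \|u\|=1}\int_{\mathbb{R}^N\setminus B_R}K(|x|)|u|^q\,dx.$$ Let $q_1,q_2>1$. (i) If $\mathcal S_0(q_1,R_1)<\infty$ and $\mathcal S_\infty(q_2,R_2)<\infty$ for some $R_1,R_2>0$, then $E$ is continuously embedded into $L^{q_1}_K+L^{q_2}_K$. (ii) If $\lim_{R\to0^+}\mathcal S_0(q_1,R)=\lim_{R\to+\infty}\mathcal S_\infty(q_2,R)=0$, then $E$ is compactly embedded into $L^{q_1}_K+L^{q_2}_K$, that is, the embedding is continuous and every bounded sequence in $E$ has a subsequence that converges in $L^{q_1}_K+L^{q_2}_K$.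 -/

import Mathlib

open Set Filter Topology MeasureTheory
open scoped ENNReal NNReal ContDiff

namespace QuasilinearSchrodinger

noncomputable section

/-! ### The change of variables -/

/-- `∫₀ˢ √(1 + 2τ²) dτ`; its inverse function is the change of variables. -/
def invChange (s : ℝ) : ℝ := ∫ τ in (0 : ℝ)..s, Real.sqrt (1 + 2 * τ ^ 2)

theorem hasDerivAt_invChange (s : ℝ) :
    HasDerivAt invChange (Real.sqrt (1 + 2 * s ^ 2)) s := by
  have hc : Continuous (fun τ : ℝ => Real.sqrt (1 + 2 * τ ^ 2)) := by fun_prop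
  exact intervalIntegral.integral_hasDerivAt_right (hc.intervalIntegrable _ _)
    (hc.stronglyMeasurableAtFilter _ _) hc.continuousAt

theorem one_le_sqrt_aux (s : ℝ) : 1 ≤ Real.sqrt (1 + 2 * s ^ 2) := by
  rw [Real.one_le_sqrt]
  nlinarith [sq_nonneg s]

theorem invChange_zero : invChange 0 = 0 := by simp [invChange]

theorem strictMono_invChange : StrictMono invChange := by
  refine strictMono_of_hasDerivAt_pos hasDerivAt_invChange fun s => ?_
  exact lt_of_lt_of_le one_pos (one_le_sqrt_aux s)

theorem surjective_invChange : Function.Surjective invChange := by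
  have hc : Continuous invChange :=
    continuous_iff_continuousAt.2 fun s => (hasDerivAt_invChange s).continuousAt
  have hm : Monotone fun s => invChange s - s := by
    refine monotone_of_hasDerivAt_nonneg
      (fun s => (hasDerivAt_invChange s).sub (hasDerivAt_id s)) fun s => ?_
    simpa using one_le_sqrt_aux s
  refine hc.surjective ?_ ?_
  · refine tendsto_atTop_mono' _ ?_ tendsto_id
    filter_upwards [eventually_ge_atTop 0] with s hs
    have := hm hs
    simp only [invChange_zero, id] at this ⊢
    linarith
  · refine tendsto_atBot_mono' _ ?_ tendsto_id
    filter_upwards [eventually_le_atBot 0] with s hs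
    have := hm hs
    simp only [invChange_zero, id] at this ⊢
    linarith

/-- The Cauchy problem `f' = 1 / √(1 + 2 f²)` on `ℝ`, `f(0) = 0`. -/
def IsChange (f : ℝ → ℝ) : Prop :=
  f 0 = 0 ∧ ∀ t, HasDerivAt f (1 / Real.sqrt (1 + 2 * f t ^ 2)) t

theorem existsUnique_isChange : ∃! f : ℝ → ℝ, IsChange f := by
  let e := strictMono_invChange.orderIsoOfSurjective _ surjective_invChange
  have he : ∀ t, invChange (e.symm t) = t := fun t => e.apply_symm_apply t
  refine ⟨e.symm, ⟨strictMono_invChange.injective (by rw [he, invChange_zero]), fun t => ?_⟩,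
    fun g hg => ?_⟩
  · rw [one_div]
    exact HasDerivAt.of_local_left_inverse e.symm.continuous.continuousAt
      (hasDerivAt_invChange _) (lt_of_lt_of_le one_pos (one_le_sqrt_aux _)).ne'
      (Eventually.of_forall he)
  · have hd : ∀ t, HasDerivAt (fun t => invChange (g t) - t) 0 t := fun t => by
      have h := ((hasDerivAt_invChange (g t)).comp t (hg.2 t)).sub (hasDerivAt_id t)
      have hne := (lt_of_lt_of_le one_pos (one_le_sqrt_aux (g t))).ne'
      rw [mul_one_div_cancel hne, sub_self] at h
      exact h
    funext t
    have h := is_const_of_deriv_eq_zero (fun t => (hd t).differentiableAt)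
      (fun t => (hd t).deriv) t 0
    simp only [hg.1, invChange_zero, sub_zero] at h
    exact strictMono_invChange.injective (by rw [he]; linarith)

/-- The change of variables `f`: the unique solution of `f' = 1 / √(1 + 2 f²)`, `f(0) = 0`. -/
def change : ℝ → ℝ := existsUnique_isChange.choose

theorem isChange_change : IsChange change := existsUnique_isChange.choose_spec.1

/-! ### The spaces `D_r^{1,2}` and `E` -/

/-- Euclidean space `ℝ^N`. Elements of function spaces are represented by functions
`Space N → ℝ`, two functions that agree almost everywhere representing the same element. -/
abbrev Space (N : ℕ) : Type := EuclideanSpace ℝ (Fin N)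

/-- `C_c^∞(ℝ^N)`. -/
def IsTest {N : ℕ} (φ : Space N → ℝ) : Prop :=
  ContDiff ℝ ∞ φ ∧ HasCompactSupport φ

/-- `C_{c,r}^∞(ℝ^N)`: the radial functions in `C_c^∞(ℝ^N)`. -/
def IsRadialTest {N : ℕ} (φ : Space N → ℝ) : Prop :=
  IsTest φ ∧ ∀ x y : Space N, ‖x‖ = ‖y‖ → φ x = φ y

/-- `G` is a weak gradient of `u`: `∫ u ∇φ = - ∫ φ G` for all test functions `φ`. -/
def IsWeakGradient {N : ℕ} (u : Space N → ℝ) (G : Space N → Space N) : Prop :=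
  LocallyIntegrable u volume ∧ LocallyIntegrable G volume ∧
    ∀ φ : Space N → ℝ, IsTest φ →
      ∫ x, u x • gradient φ x = - ∫ x, φ x • G x

open Classical in
/-- The weak gradient `∇u` (unique up to null sets), for those `u` that have one. -/
def weakGradient {N : ℕ} (u : Space N → ℝ) : Space N → Space N :=
  if h : ∃ G, IsWeakGradient u G then h.choose else 0

/-- The norm `‖u‖_{1,2} = (∫ |∇u|²)^{1/2}`. -/
def dNorm {N : ℕ} (u : Space N → ℝ) : ℝ≥0∞ := eLpNorm (weakGradient u) 2 volume

/-- The critical Sobolev exponent `2^* = 2N / (N - 2)`. -/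
def critExp (N : ℕ) : ℝ≥0∞ := ENNReal.ofReal (2 * (N : ℝ) / ((N : ℝ) - 2))

/-- `D_r^{1,2}(ℝ^N)`, the closure of `C_{c,r}^∞(ℝ^N)` with respect to `‖·‖_{1,2}`. The abstract
completion is realized in the usual way as a space of functions: by the Sobolev inequality, a
sequence in `C_{c,r}^∞(ℝ^N)` that is Cauchy for `‖·‖_{1,2}` converges in `L^{2^*}`, and its limit
has a weak gradient, which is the `L²` limit of the gradients. -/
def DSpace (N : ℕ) : Set (Space N → ℝ) :=
  {u | MemLp u (critExp N) volume ∧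
    (∃ G, IsWeakGradient u G ∧ MemLp G 2 volume) ∧
    ∃ φ : ℕ → Space N → ℝ, (∀ n, IsRadialTest (φ n)) ∧
      Tendsto (fun n => eLpNorm (φ n - u) (critExp N) volume) atTop (𝓝 0) ∧
      Tendsto (fun n => eLpNorm (gradient (φ n) - weakGradient u) 2 volume) atTop (𝓝 0)}

/-- `∫ V(|x|) f(u)² dx`. -/
def modular {N : ℕ} (V : ℝ → ℝ) (u : Space N → ℝ) : ℝ≥0∞ :=
  ∫⁻ x, ENNReal.ofReal (V ‖x‖ * change (u x) ^ 2)

/-- `E = {u ∈ D_r^{1,2}(ℝ^N) | ∫ V(|x|) f(u)² dx < ∞}`. -/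
def ESpace (N : ℕ) (V : ℝ → ℝ) : Set (Space N → ℝ) :=
  {u | u ∈ DSpace N ∧ modular V u < ⊤}

/-- The Orlicz norm `‖u‖_o = inf_{k > 0} (1 / k) (1 + ∫ V(|x|) f(k u)² dx)`. -/
def orliczNorm {N : ℕ} (V : ℝ → ℝ) (u : Space N → ℝ) : ℝ≥0∞ :=
  ⨅ (k : ℝ) (_ : 0 < k), ENNReal.ofReal (1 / k) * (1 + modular V (fun x => k * u x))

/-- The norm `‖u‖ = ‖u‖_{1,2} + ‖u‖_o` of `E`. -/
def eNorm {N : ℕ} (V : ℝ → ℝ) (u : Space N → ℝ) : ℝ≥0∞ :=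
  dNorm u + orliczNorm V u

/-! ### The space `L_K^{q₁} + L_K^{q₂}` -/

/-- The measure `K(|x|) dx` on `ℝ^N`. -/
def weightedMeasure (N : ℕ) (K : ℝ → ℝ) : Measure (Space N) :=
  volume.withDensity fun x => ENNReal.ofReal (K ‖x‖)

/-- `u = u₁ + u₂` almost everywhere with `u₁ ∈ L_K^{q₁}(ℝ^N)` and `u₂ ∈ L_K^{q₂}(ℝ^N)`. -/
def IsDecomposition {N : ℕ} (K : ℝ → ℝ) (q₁ q₂ : ℝ) (u u₁ u₂ : Space N → ℝ) : Prop :=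
  MemLp u₁ (ENNReal.ofReal q₁) (weightedMeasure N K) ∧
    MemLp u₂ (ENNReal.ofReal q₂) (weightedMeasure N K) ∧
    u =ᵐ[volume] u₁ + u₂

/-- `L_K^{q₁}(ℝ^N) + L_K^{q₂}(ℝ^N)`. -/
def SumSpace (N : ℕ) (K : ℝ → ℝ) (q₁ q₂ : ℝ) : Set (Space N → ℝ) :=
  {u | ∃ u₁ u₂, IsDecomposition K q₁ q₂ u u₁ u₂}

/-- `inf_{u₁ + u₂ = u} max {‖u₁‖_{L_K^{q₁}}, ‖u₂‖_{L_K^{q₂}}}`. -/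
def sumNorm {N : ℕ} (K : ℝ → ℝ) (q₁ q₂ : ℝ) (u : Space N → ℝ) : ℝ≥0∞ :=
  ⨅ (u₁ : Space N → ℝ) (u₂ : Space N → ℝ) (_ : IsDecomposition K q₁ q₂ u u₁ u₂),
    max (eLpNorm u₁ (ENNReal.ofReal q₁) (weightedMeasure N K))
      (eLpNorm u₂ (ENNReal.ofReal q₂) (weightedMeasure N K))

/-! ### Embeddings and the functions `S₀`, `S_∞` -/

/-- The function space `A` with norm `a` is continuously embedded into the function space `B`
with norm `b`: `A ⊆ B` and the (linear) inclusion is bounded. -/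
def ContinuouslyEmbedded {N : ℕ} (A : Set (Space N → ℝ)) (a : (Space N → ℝ) → ℝ≥0∞)
    (B : Set (Space N → ℝ)) (b : (Space N → ℝ) → ℝ≥0∞) : Prop :=
  A ⊆ B ∧ ∃ C : ℝ≥0, ∀ u ∈ A, b u ≤ C * a u

/-- `A` is compactly embedded into `B`: the inclusion is continuous and maps bounded subsets of
`A` to relatively compact subsets of `B`, i.e. every sequence in `A` that is bounded in `A` has
a subsequence that converges in `B`. -/
def CompactlyEmbedded {N : ℕ} (A : Set (Space N → ℝ)) (a : (Space N → ℝ) → ℝ≥0∞)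
    (B : Set (Space N → ℝ)) (b : (Space N → ℝ) → ℝ≥0∞) : Prop :=
  ContinuouslyEmbedded A a B b ∧
    ∀ u : ℕ → Space N → ℝ, (∀ n, u n ∈ A) → (∃ M : ℝ≥0, ∀ n, a (u n) ≤ M) →
      ∃ v ∈ B, ∃ σ : ℕ → ℕ, StrictMono σ ∧
        Tendsto (fun n => b (u (σ n) - v)) atTop (𝓝 0)

/-- `S₀(q, R) = sup {∫_{B_R} K(|x|) |u|^q dx | u ∈ E, ‖u‖ = 1}`, with values in `[0, ∞]`. -/
def S0 (N : ℕ) (V K : ℝ → ℝ) (q R : ℝ) : ℝ≥0∞ :=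
  ⨆ u ∈ {u ∈ ESpace N V | eNorm V u = 1},
    ∫⁻ x in Metric.ball (0 : Space N) R, ENNReal.ofReal (K ‖x‖ * |u x| ^ q)

/-- `S_∞(q, R) = sup {∫_{ℝ^N \ B_R} K(|x|) |u|^q dx | u ∈ E, ‖u‖ = 1}`, with values in
`[0, ∞]`. -/
def SInf (N : ℕ) (V K : ℝ → ℝ) (q R : ℝ) : ℝ≥0∞ :=
  ⨆ u ∈ {u ∈ ESpace N V | eNorm V u = 1},
    ∫⁻ x in (Metric.ball (0 : Space N) R)ᶜ, ENNReal.ofReal (K ‖x‖ * |u x| ^ q)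

end

end QuasilinearSchrodinger

namespace QuasilinearSchrodinger

/-! ### Dilations of the change of variables -/

theorem change_zero : change 0 = 0 := isChange_change.1

theorem hasDerivAt_change (t : ℝ) :
    HasDerivAt change (1 / Real.sqrt (1 + 2 * change t ^ 2)) t := isChange_change.2 t

theorem monotone_change : Monotone change :=
  monotone_of_hasDerivAt_nonneg hasDerivAt_change fun t => by positivity

theorem change_nonneg {t : ℝ} (ht : 0 ≤ t) : 0 ≤ change t := by
  simpa [change_zero] using monotone_change ht

theorem change_nonpos {t : ℝ} (ht : t ≤ 0) : change t ≤ 0 := by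
  simpa [change_zero] using monotone_change ht

theorem sq_change_le_sq_change_mul {c : ℝ} (hc : 1 ≤ c) (t : ℝ) :
    change t ^ 2 ≤ change (c * t) ^ 2 := by
  rcases le_total 0 t with ht | ht
  · exact pow_le_pow_left₀ (change_nonneg ht) (monotone_change (by nlinarith)) 2
  · have h1 := change_nonpos ht
    have h2 : change (c * t) ≤ change t := monotone_change (by nlinarith)
    nlinarith

theorem sq_change_mul_le_of_one_le {c : ℝ} (hc : 1 ≤ c) (t : ℝ) :
    change (c * t) ^ 2 ≤ c ^ 2 * change t ^ 2 := by
  have hd : ∀ t, HasDerivAt (fun t => c * change t - change (c * t))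
      (c * (1 / Real.sqrt (1 + 2 * change t ^ 2)) -
        1 / Real.sqrt (1 + 2 * change (c * t) ^ 2) * c) t := fun t => by
    have h := (hasDerivAt_change (c * t)).comp t ((hasDerivAt_id t).const_mul c)
    rw [mul_one] at h
    exact ((hasDerivAt_change t).const_mul c).sub h
  have hm : Monotone fun t => c * change t - change (c * t) := by
    refine monotone_of_hasDerivAt_nonneg hd fun t => ?_
    have h1 : 1 / Real.sqrt (1 + 2 * change (c * t) ^ 2) ≤
        1 / Real.sqrt (1 + 2 * change t ^ 2) := by
      apply one_div_le_one_div_of_le (by positivity)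
      apply Real.sqrt_le_sqrt
      linarith [sq_change_le_sq_change_mul hc t]
    simp only [Pi.zero_apply]
    nlinarith
  rw [← mul_pow]
  rcases le_total 0 t with ht | ht
  · have h := hm ht
    simp only [change_zero, mul_zero, sub_zero] at h
    exact pow_le_pow_left₀ (change_nonneg (by positivity)) (by linarith) 2
  · have h := hm ht
    simp only [change_zero, mul_zero, sub_zero] at h
    have h0 : change (c * t) ≤ 0 := change_nonpos (by nlinarith)
    nlinarith

theorem exists_sq_change_mul_le {c : ℝ} (hc : 0 < c) :
    ∃ B : ℝ, 0 ≤ B ∧ ∀ t, change (c * t) ^ 2 ≤ B * change t ^ 2 := by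
  rcases le_total 1 c with h | h
  · exact ⟨c ^ 2, by positivity, sq_change_mul_le_of_one_le h⟩
  · refine ⟨1, zero_le_one, fun t => ?_⟩
    have := sq_change_le_sq_change_mul (one_le_inv_iff₀.2 ⟨hc, h⟩) (c * t)
    rwa [inv_mul_cancel_left₀ hc.ne', ← one_mul (change t ^ 2)] at this

/-! ### Weak gradients -/

section WeakGradient

variable {N : ℕ} {u : Space N → ℝ} {G H : Space N → Space N}

theorem IsWeakGradient.ae_eq (hG : IsWeakGradient u G) (hH : IsWeakGradient u H) :
    G =ᵐ[volume] H := by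
  refine ae_eq_of_integral_contDiff_smul_eq hG.2.1 hH.2.1 fun φ hφ hc => ?_
  have h1 := hG.2.2 φ ⟨hφ, hc⟩
  rw [hH.2.2 φ ⟨hφ, hc⟩] at h1
  exact (neg_injective h1).symm

theorem IsWeakGradient.const_smul (hG : IsWeakGradient u G) (c : ℝ) :
    IsWeakGradient (c • u) (c • G) := by
  refine ⟨hG.1.smul c, hG.2.1.smul c, fun φ hφ => ?_⟩
  have h := hG.2.2 φ hφ
  simp only [Pi.smul_apply, smul_eq_mul, mul_smul]
  rw [integral_smul, h, smul_neg, ← integral_smul]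
  simp only [smul_comm c]

theorem isWeakGradient_weakGradient (h : ∃ G, IsWeakGradient u G) :
    IsWeakGradient u (weakGradient u) := by
  rw [weakGradient, dif_pos h]
  exact h.choose_spec

theorem weakGradient_ae_eq (hG : IsWeakGradient u G) : weakGradient u =ᵐ[volume] G :=
  (isWeakGradient_weakGradient ⟨G, hG⟩).ae_eq hG

end WeakGradient

theorem gradient_const_smul {N : ℕ} {φ : Space N → ℝ} (c : ℝ) :
    gradient (c • φ) = c • gradient φ := by
  ext1 x
  simp only [gradient, Pi.smul_apply]
  rw [fderiv_const_smul_field, Pi.smul_apply, map_smul]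

theorem IsRadialTest.const_smul {N : ℕ} {φ : Space N → ℝ} (hφ : IsRadialTest φ) (c : ℝ) :
    IsRadialTest (c • φ) :=
  ⟨⟨hφ.1.1.const_smul c, hφ.1.2.smul_left (f := fun _ => c)⟩,
    fun x y h => by simp [hφ.2 x y h]⟩

/-! ### The space `E` and its norm -/

section ESpace

variable {N : ℕ} {V : ℝ → ℝ} {u : Space N → ℝ}

theorem isWeakGradient_of_mem_DSpace (hu : u ∈ DSpace N) :
    IsWeakGradient u (weakGradient u) :=
  let ⟨_, ⟨G, hG, _⟩, _⟩ := hu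
  isWeakGradient_weakGradient ⟨G, hG⟩

theorem memLp_weakGradient (hu : u ∈ DSpace N) : MemLp (weakGradient u) 2 volume := by
  obtain ⟨_, ⟨G, hG, hG2⟩, _⟩ := hu
  exact hG2.ae_eq (weakGradient_ae_eq hG).symm

theorem dNorm_lt_top (hu : u ∈ DSpace N) : dNorm u < ⊤ := (memLp_weakGradient hu).2

theorem weakGradient_const_smul (hu : u ∈ DSpace N) (c : ℝ) :
    weakGradient (c • u) =ᵐ[volume] c • weakGradient u :=
  weakGradient_ae_eq ((isWeakGradient_of_mem_DSpace hu).const_smul c)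

theorem dNorm_const_smul (hu : u ∈ DSpace N) (c : ℝ) : dNorm (c • u) = ‖c‖ₑ * dNorm u := by
  rw [dNorm, eLpNorm_congr_ae (weakGradient_const_smul hu c), eLpNorm_const_smul, dNorm]

theorem const_smul_mem_DSpace (hu : u ∈ DSpace N) (c : ℝ) : c • u ∈ DSpace N := by
  have hw := weakGradient_const_smul hu c
  obtain ⟨h1, ⟨G, hG, hG2⟩, φ, hφ, hφ1, hφ2⟩ := hu
  have hscale : ∀ (F : ℕ → ℝ≥0∞), Tendsto F atTop (𝓝 0) →
      Tendsto (fun n => ‖c‖ₑ * F n) atTop (𝓝 0) := fun F hF => by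
    simpa using ENNReal.Tendsto.const_mul (a := ‖c‖ₑ) hF (Or.inr enorm_ne_top)
  refine ⟨h1.const_smul c, ⟨c • G, hG.const_smul c, hG2.const_smul c⟩,
    fun n => c • φ n, fun n => (hφ n).const_smul c, ?_, ?_⟩
  · refine (hscale _ hφ1).congr fun n => ?_
    rw [← smul_sub, eLpNorm_const_smul]
  · refine (hscale _ hφ2).congr fun n => ?_
    rw [← eLpNorm_const_smul, smul_sub, gradient_const_smul]
    refine eLpNorm_congr_ae ?_
    filter_upwards [hw] with x hx
    simp [hx]

theorem modular_const_smul_lt_top (hV : ∀ r, 0 < r → 0 ≤ V r) [Nontrivial (Space N)]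
    (hu : modular V u < ⊤) {c : ℝ} (hc : 0 < c) : modular V (c • u) < ⊤ := by
  obtain ⟨B, hB, h⟩ := exists_sq_change_mul_le hc
  have : modular V (c • u) ≤ ENNReal.ofReal B * modular V u := by
    rw [modular, modular, ← lintegral_const_mul' _ _ ENNReal.ofReal_ne_top]
    refine lintegral_mono_ae ?_
    filter_upwards [Measure.ae_ne (volume : Measure (Space N)) 0] with x hx
    rw [← ENNReal.ofReal_mul hB]
    refine ENNReal.ofReal_le_ofReal ?_
    have := mul_le_mul_of_nonneg_left (h (u x)) (hV ‖x‖ (norm_pos_iff.2 hx))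
    simp only [Pi.smul_apply, smul_eq_mul]
    linarith
  exact this.trans_lt (ENNReal.mul_lt_top ENNReal.ofReal_lt_top hu)

theorem const_smul_mem_ESpace (hV : ∀ r, 0 < r → 0 ≤ V r) [Nontrivial (Space N)]
    (hu : u ∈ ESpace N V) {c : ℝ} (hc : 0 < c) : c • u ∈ ESpace N V :=
  ⟨const_smul_mem_DSpace hu.1 c, modular_const_smul_lt_top hV hu.2 hc⟩

theorem orliczNorm_const_smul_le (u : Space N → ℝ) {c : ℝ} (hc : 0 < c) :
    orliczNorm V (c • u) ≤ ENNReal.ofReal c * orliczNorm V u := by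
  simp only [orliczNorm]
  rw [ENNReal.mul_iInf_of_ne (by simpa using hc) ENNReal.ofReal_ne_top]
  refine le_iInf fun k => ?_
  rw [ENNReal.mul_iInf_of_ne (by simpa using hc) ENNReal.ofReal_ne_top]
  refine le_iInf fun hk => ?_
  refine (iInf₂_le (k / c) (div_pos hk hc)).trans (le_of_eq ?_)
  rw [← mul_assoc, ← ENNReal.ofReal_mul hc.le]
  congr 3
  · field_simp
  · ext x
    simp only [Pi.smul_apply, smul_eq_mul]
    field_simp

theorem orliczNorm_const_smul (u : Space N → ℝ) {c : ℝ} (hc : 0 < c) :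
    orliczNorm V (c • u) = ENNReal.ofReal c * orliczNorm V u := by
  refine (orliczNorm_const_smul_le u hc).antisymm ?_
  have h := orliczNorm_const_smul_le (V := V) (c • u) (inv_pos.2 hc)
  rw [inv_smul_smul₀ hc.ne'] at h
  calc ENNReal.ofReal c * orliczNorm V u
      ≤ ENNReal.ofReal c * (ENNReal.ofReal c⁻¹ * orliczNorm V (c • u)) := by gcongr
    _ = orliczNorm V (c • u) := by
      rw [← mul_assoc, ← ENNReal.ofReal_mul hc.le, mul_inv_cancel₀ hc.ne', ENNReal.ofReal_one,
        one_mul]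

theorem eNorm_const_smul (hu : u ∈ DSpace N) {c : ℝ} (hc : 0 < c) :
    eNorm V (c • u) = ENNReal.ofReal c * eNorm V u := by
  rw [eNorm, dNorm_const_smul hu, orliczNorm_const_smul u hc, Real.enorm_of_nonneg hc.le,
    ← mul_add, eNorm]

theorem orliczNorm_le (u : Space N → ℝ) : orliczNorm V u ≤ 1 + modular V u := by
  refine (iInf₂_le 1 one_pos).trans (le_of_eq ?_)
  simp

theorem eNorm_lt_top (hu : u ∈ ESpace N V) : eNorm V u < ⊤ :=
  ENNReal.add_lt_top.2 ⟨dNorm_lt_top hu.1,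
    (orliczNorm_le u).trans_lt (ENNReal.add_lt_top.2 ⟨ENNReal.one_lt_top, hu.2⟩)⟩

theorem dNorm_le_eNorm (u : Space N → ℝ) : dNorm u ≤ eNorm V u := le_self_add

end ESpace

/-! ### Pointwise estimates for radial test functions -/

/-- `∫ₜ^∞ τ^{-(N-1)} dτ` for `t > 0`. -/
noncomputable def radialGauge (N : ℕ) (t : ℝ) : ℝ := (((N : ℝ) - 2) * t ^ (N - 2))⁻¹

section RadialGauge

variable {N : ℕ}

theorem radialGauge_pos (hN : 3 ≤ N) {t : ℝ} (ht : 0 < t) : 0 < radialGauge N t := by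
  have : (3 : ℝ) ≤ N := by exact_mod_cast hN
  exact inv_pos.2 (mul_pos (by linarith) (by positivity))

theorem radialGauge_anti (hN : 3 ≤ N) {s t : ℝ} (hs : 0 < s) (hst : s ≤ t) :
    radialGauge N t ≤ radialGauge N s := by
  have : (3 : ℝ) ≤ N := by exact_mod_cast hN
  exact inv_anti₀ (mul_pos (by linarith) (by positivity))
    (mul_le_mul_of_nonneg_left (pow_le_pow_left₀ hs.le hst _) (by linarith))

theorem hasDerivAt_radialGauge (hN : 3 ≤ N) {t : ℝ} (ht : 0 < t) :
    HasDerivAt (radialGauge N) (-(t ^ (N - 1))⁻¹) t := by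
  obtain ⟨m, rfl⟩ : ∃ m, N = m + 3 := ⟨N - 3, by omega⟩
  have hm : ((m + 3 : ℕ) : ℝ) - 2 = m + 1 := by push_cast; ring
  have h := (((hasDerivAt_pow (m + 1) t).const_mul ((m : ℝ) + 1)).inv (by positivity))
  unfold radialGauge
  rw [hm]
  refine h.congr_deriv ?_
  have e1 : m + 3 - 1 = m + 2 := rfl
  rw [e1]
  push_cast
  field_simp
  ring

theorem continuousAt_radialGauge (hN : 3 ≤ N) {t : ℝ} (ht : 0 < t) :
    ContinuousAt (radialGauge N) t :=
  (hasDerivAt_radialGauge hN ht).continuousAt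

theorem intervalIntegral_inv_pow (hN : 3 ≤ N) {r s : ℝ} (hr : 0 < r) (hrs : r ≤ s) :
    ∫ t in r..s, (t ^ (N - 1))⁻¹ = radialGauge N r - radialGauge N s := by
  have hpos : ∀ t ∈ uIcc r s, 0 < t := fun t ht => by
    rw [uIcc_of_le hrs] at ht
    exact hr.trans_le ht.1
  rw [intervalIntegral.integral_eq_sub_of_hasDerivAt (f := fun t => -radialGauge N t)]
  · ring
  · intro t ht
    exact (hasDerivAt_radialGauge hN (hpos t ht)).neg.congr_deriv (neg_neg _)
  · refine ContinuousOn.intervalIntegrable fun t ht => ?_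
    have := (hpos t ht).ne'
    exact ContinuousAt.continuousWithinAt (by fun_prop (disch := positivity))

/-- The Cauchy-Schwarz inequality for `ψ(s) - ψ(r) = ∫ᵣˢ ψ'` with weight `t^{N-1}`. -/
theorem sq_sub_le_mul_radialGauge (hN : 3 ≤ N) {ψ ψ' : ℝ → ℝ} (hψ : ∀ t, HasDerivAt ψ (ψ' t) t)
    (hc : Continuous ψ') {r s : ℝ} (hr : 0 < r) (hrs : r ≤ s) :
    (ψ s - ψ r) ^ 2 ≤
      (∫ t in r..s, t ^ (N - 1) * ψ' t ^ 2) * (radialGauge N r - radialGauge N s) := by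
  have hpos : ∀ t ∈ uIcc r s, t ≠ 0 := fun t ht => by
    rw [uIcc_of_le hrs] at ht
    exact (hr.trans_le ht.1).ne'
  set P := ∫ t in r..s, t ^ (N - 1) * ψ' t ^ 2 with hP
  set Q := radialGauge N r - radialGauge N s with hQ
  have hQ0 : 0 ≤ Q := sub_nonneg.2 (radialGauge_anti hN hr hrs)
  have hint : IntervalIntegrable (fun t => (t ^ (N - 1))⁻¹) volume r s := by
    refine ContinuousOn.intervalIntegrable fun t ht => ?_
    have := hpos t ht
    exact ContinuousAt.continuousWithinAt (by fun_prop (disch := positivity))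
  have hi1 : IntervalIntegrable (fun t => t ^ (N - 1) * ψ' t ^ 2) volume r s :=
    Continuous.intervalIntegrable (by fun_prop) _ _
  have hi2 : IntervalIntegrable ψ' volume r s := hc.intervalIntegrable _ _
  have hD : ∫ t in r..s, ψ' t = ψ s - ψ r :=
    intervalIntegral.integral_eq_sub_of_hasDerivAt (fun t _ => hψ t) hi2
  have key : ∀ l : ℝ, 0 ≤ P - 2 * l * (ψ s - ψ r) + l ^ 2 * Q := fun l => by
    have e : ∫ t in r..s, (t ^ (N - 1) * ψ' t ^ 2 - 2 * l * ψ' t + l ^ 2 * (t ^ (N - 1))⁻¹) =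
        P - 2 * l * (ψ s - ψ r) + l ^ 2 * Q := by
      rw [intervalIntegral.integral_add (hi1.sub (hi2.const_mul _)) (hint.const_mul _),
        intervalIntegral.integral_sub hi1 (hi2.const_mul _),
        intervalIntegral.integral_const_mul, intervalIntegral.integral_const_mul, hD,
        intervalIntegral_inv_pow hN hr hrs]
    rw [← e]
    refine intervalIntegral.integral_nonneg hrs fun t ht => ?_
    have ht0 : 0 < t := hr.trans_le ht.1
    have : t ^ (N - 1) * ψ' t ^ 2 - 2 * l * ψ' t + l ^ 2 * (t ^ (N - 1))⁻¹ =
        t ^ (N - 1) * (ψ' t - l * (t ^ (N - 1))⁻¹) ^ 2 := by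
      field_simp
      ring
    rw [this]
    positivity
  have hdisc := discrim_le_zero (a := Q) (b := -2 * (ψ s - ψ r)) (c := P) fun l => by
    have := key l
    nlinarith
  rw [discrim] at hdisc
  nlinarith

end RadialGauge

section RadialTest

variable {N : ℕ} {φ : Space N → ℝ}

theorem IsTest.continuous_gradient (hφ : IsTest φ) : Continuous (gradient φ) :=
  (InnerProductSpace.toDual ℝ (Space N)).symm.continuous.comp
    (hφ.1.continuous_fderiv (by simp))

theorem IsTest.memLp_gradient (hφ : IsTest φ) (p : ℝ≥0∞) :
    MemLp (gradient φ) p volume := by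
  refine hφ.continuous_gradient.memLp_of_hasCompactSupport ?_
  exact (hφ.2.fderiv (𝕜 := ℝ)).comp_left (map_zero _)

theorem IsTest.hasDerivAt_comp_smul (hφ : IsTest φ) (e : Space N) (t : ℝ) :
    HasDerivAt (fun t : ℝ => φ (t • e)) (inner ℝ (gradient φ (t • e)) e) t := by
  have h1 : HasFDerivAt φ (fderiv ℝ φ (t • e)) (t • e) :=
    (hφ.1.differentiable (by simp) _).hasFDerivAt
  have h2 : HasDerivAt (fun t : ℝ => t • e) e t := by
    simpa using (hasDerivAt_id t).smul_const e
  rw [inner_gradient_left]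
  exact h1.comp_hasDerivAt t h2

theorem IsRadialTest.abs_inner_gradient_le (hφ : IsRadialTest φ) {e : Space N} (he : ‖e‖ = 1)
    {x : Space N} (hx : x ≠ 0) :
    |inner ℝ (gradient φ (‖x‖ • e)) e| ≤ ‖gradient φ x‖ := by
  have hx0 := norm_ne_zero_iff.2 hx
  set w : Space N := ‖x‖⁻¹ • x with hw
  have hwn : ‖w‖ = 1 := by rw [hw, norm_smul, norm_inv, norm_norm, inv_mul_cancel₀ hx0]
  have hf : (fun t : ℝ => φ (t • e)) = fun t : ℝ => φ (t • w) := by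
    funext t
    exact hφ.2 _ _ (by rw [norm_smul, norm_smul, he, hwn])
  have h1 := hφ.1.hasDerivAt_comp_smul e ‖x‖
  rw [hf] at h1
  rw [h1.unique (hφ.1.hasDerivAt_comp_smul w ‖x‖), hw, smul_inv_smul₀ hx0, ← hw]
  simpa [hwn] using abs_real_inner_le_norm (gradient φ x) w

theorem IsRadialTest.integral_sq_inner_gradient_le [Nontrivial (Space N)] (hφ : IsRadialTest φ)
    {e : Space N} (he : ‖e‖ = 1) {r s : ℝ} (hr : 0 < r) (hrs : r ≤ s) :
    ∫ t in r..s, t ^ (N - 1) * inner ℝ (gradient φ (t • e)) e ^ 2 ≤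
      (N * volume.real (Metric.ball (0 : Space N) 1))⁻¹ * ∫ x, ‖gradient φ x‖ ^ 2 := by
  have hgc := hφ.1.continuous_gradient
  have hN : Module.finrank ℝ (Space N) = N := by simp
  have hNpos : 0 < N := hN ▸ Module.finrank_pos
  have hvol : 0 < volume.real (Metric.ball (0 : Space N) 1) :=
    ENNReal.toReal_pos (Metric.measure_ball_pos _ _ one_pos).ne' measure_ball_lt_top.ne
  have hi : Integrable (fun x : Space N => ‖gradient φ x‖ ^ 2) :=
    (hφ.1.memLp_gradient 2).integrable_norm_pow (by simp)
  have hle : ∀ᵐ x : Space N, inner ℝ (gradient φ (‖x‖ • e)) e ^ 2 ≤ ‖gradient φ x‖ ^ 2 := by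
    filter_upwards [Measure.ae_ne (volume : Measure (Space N)) 0] with x hx
    exact sq_le_sq' (neg_le_of_abs_le (hφ.abs_inner_gradient_le he hx))
      (le_of_abs_le (hφ.abs_inner_gradient_le he hx))
  have hi' : Integrable (fun x : Space N => inner ℝ (gradient φ (‖x‖ • e)) e ^ 2) := by
    refine hi.mono' (Continuous.aestronglyMeasurable (by fun_prop)) ?_
    filter_upwards [hle] with x hx
    rwa [Real.norm_of_nonneg (sq_nonneg _)]
  have hpol := integral_fun_norm_addHaar (volume : Measure (Space N))
    (fun t => inner ℝ (gradient φ (t • e)) e ^ 2)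
  have hion := (integrable_fun_norm_addHaar (volume : Measure (Space N))
    (f := fun t => inner ℝ (gradient φ (t • e)) e ^ 2)).1 hi'
  rw [hN] at hpol hion
  simp only [nsmul_eq_mul, smul_eq_mul] at hpol hion
  have h1 : ∫ t in r..s, t ^ (N - 1) * inner ℝ (gradient φ (t • e)) e ^ 2 ≤
      ∫ t in Ioi 0, t ^ (N - 1) * inner ℝ (gradient φ (t • e)) e ^ 2 := by
    rw [intervalIntegral.integral_of_le hrs]
    refine setIntegral_mono_set hion ?_ (LE.le.eventuallyLE
      fun t ht => hr.trans ht.1)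
    filter_upwards [ae_restrict_mem measurableSet_Ioi] with t ht
    have : (0 : ℝ) < t := ht
    simp only [Pi.zero_apply]
    positivity
  refine h1.trans ?_
  rw [inv_mul_eq_div, le_div_iff₀ (by positivity)]
  calc _ = ∫ x : Space N, inner ℝ (gradient φ (‖x‖ • e)) e ^ 2 := by rw [hpol]; ring
    _ ≤ _ := integral_mono_ae hi' hi hle

/-- The constant in the pointwise estimates for radial functions. -/
noncomputable def radialConst (N : ℕ) : ℝ :=
  ((N : ℝ) * volume.real (Metric.ball (0 : Space N) 1))⁻¹

theorem radialConst_nonneg (N : ℕ) : 0 ≤ radialConst N := by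
  unfold radialConst
  positivity

theorem nontrivial_space (hN : 3 ≤ N) : Nontrivial (Space N) := by
  have : Nonempty (Fin N) := ⟨⟨0, by omega⟩⟩
  infer_instance

theorem IsTest.integral_sq_norm_gradient (hφ : IsTest φ) :
    ∫ x, ‖gradient φ x‖ ^ 2 = (eLpNorm (gradient φ) 2 volume).toReal ^ 2 := by
  have h0 : 0 ≤ ∫ x, ‖gradient φ x‖ ^ 2 := integral_nonneg fun x => by positivity
  rw [(hφ.memLp_gradient 2).eLpNorm_eq_integral_rpow_norm two_ne_zero ENNReal.ofNat_ne_top]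
  simp only [ENNReal.toReal_ofNat, Real.rpow_two]
  rw [ENNReal.toReal_ofReal (by positivity), ← Real.rpow_natCast, ← Real.rpow_mul h0]
  norm_num

theorem IsRadialTest.sq_sub_le (hN : 3 ≤ N) (hφ : IsRadialTest φ) {x y : Space N} (hx : x ≠ 0)
    (hxy : ‖x‖ ≤ ‖y‖) :
    (φ y - φ x) ^ 2 ≤ radialConst N * (eLpNorm (gradient φ) 2 volume).toReal ^ 2 *
      (radialGauge N ‖x‖ - radialGauge N ‖y‖) := by
  have := nontrivial_space hN
  obtain ⟨e, he⟩ := exists_norm_eq (Space N) zero_le_one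
  have hx0 : 0 < ‖x‖ := norm_pos_iff.2 hx
  have hgc := hφ.1.continuous_gradient
  have hr : ∀ z : Space N, φ (‖z‖ • e) = φ z := fun z =>
    hφ.2 _ _ (by rw [norm_smul, norm_norm, he, mul_one])
  have h1 := sq_sub_le_mul_radialGauge hN (hφ.1.hasDerivAt_comp_smul e) (by fun_prop) hx0 hxy
  rw [hr, hr] at h1
  refine h1.trans ?_
  refine mul_le_mul_of_nonneg_right ?_ (sub_nonneg.2 (radialGauge_anti hN hx0 hxy))
  rw [← hφ.1.integral_sq_norm_gradient]
  exact hφ.integral_sq_inner_gradient_le he hx0 hxy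

theorem IsRadialTest.sq_le (hN : 3 ≤ N) (hφ : IsRadialTest φ) {x : Space N} (hx : x ≠ 0) :
    φ x ^ 2 ≤ radialConst N * (eLpNorm (gradient φ) 2 volume).toReal ^ 2 *
      radialGauge N ‖x‖ := by
  have := nontrivial_space hN
  have hx0 : 0 < ‖x‖ := norm_pos_iff.2 hx
  obtain ⟨R, hR⟩ := hφ.1.2.isCompact.isBounded.subset_closedBall (0 : Space N)
  obtain ⟨y, hy⟩ := exists_norm_eq (Space N)
    (show 0 ≤ max ‖x‖ (R + 1) from hx0.le.trans (le_max_left _ _))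
  have hxy : ‖x‖ ≤ ‖y‖ := hy ▸ le_max_left _ _
  have hφy : φ y = 0 := by
    by_contra h
    have h1 : ‖y‖ ≤ R := by simpa using hR (subset_tsupport φ h)
    have h2 : R + 1 ≤ ‖y‖ := hy ▸ le_max_right _ _
    linarith
  have h1 := hφ.sq_sub_le hN hx hxy
  rw [hφy, zero_sub, neg_sq] at h1
  refine h1.trans (mul_le_mul_of_nonneg_left ?_ ?_)
  · linarith [radialGauge_pos hN (hx0.trans_le hxy)]
  · exact mul_nonneg (radialConst_nonneg N) (sq_nonneg _)

theorem IsRadialTest.sq_sub_le_abs (hN : 3 ≤ N) (hφ : IsRadialTest φ) {x y : Space N}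
    (hx : x ≠ 0) (hy : y ≠ 0) :
    (φ x - φ y) ^ 2 ≤ radialConst N * (eLpNorm (gradient φ) 2 volume).toReal ^ 2 *
      |radialGauge N ‖x‖ - radialGauge N ‖y‖| := by
  rcases le_total ‖x‖ ‖y‖ with h | h
  · rw [abs_of_nonneg (sub_nonneg.2 (radialGauge_anti hN (norm_pos_iff.2 hx) h)), ← neg_sub,
      neg_sq]
    exact hφ.sq_sub_le hN hx h
  · rw [abs_sub_comm, abs_of_nonneg (sub_nonneg.2 (radialGauge_anti hN (norm_pos_iff.2 hy) h))]
    exact hφ.sq_sub_le hN hy h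

end RadialTest

/-! ### Pointwise estimates in `D_r^{1,2}` and convergent subsequences -/

section DSpace

variable {N : ℕ} {u : Space N → ℝ}

theorem critExp_ne_zero (hN : 3 ≤ N) : critExp N ≠ 0 := by
  have : (3 : ℝ) ≤ N := by exact_mod_cast hN
  exact (ENNReal.ofReal_pos.2 (div_pos (by linarith) (by linarith))).ne'

/-- The squared modulus of continuity, away from the origin, of functions of `D_r^{1,2}` with
`‖u‖_{1,2} ≤ d`, on a set `S` of full measure. -/
structure RadialEstimate (S : Set (Space N)) (d : ℝ) (u : Space N → ℝ) : Prop where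
  sq_le : ∀ x ∈ S, u x ^ 2 ≤ radialConst N * d ^ 2 * radialGauge N ‖x‖
  sq_sub_le : ∀ x ∈ S, ∀ y ∈ S, (u x - u y) ^ 2 ≤
    radialConst N * d ^ 2 * |radialGauge N ‖x‖ - radialGauge N ‖y‖|

theorem exists_radialEstimate (hN : 3 ≤ N) (hu : u ∈ DSpace N) :
    ∃ S : Set (Space N), (∀ᵐ x, x ∈ S) ∧ (∀ x ∈ S, x ≠ 0) ∧
      RadialEstimate S (dNorm u).toReal u := by
  have := nontrivial_space hN
  have hw := memLp_weakGradient hu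
  obtain ⟨h1, -, φ, hφ, hφ1, hφ2⟩ := hu
  obtain ⟨ns, hns, hae⟩ := (tendstoInMeasure_of_tendsto_eLpNorm (critExp_ne_zero hN)
    (fun n => (hφ n).1.1.continuous.aestronglyMeasurable) h1.1 hφ1).exists_seq_tendsto_ae
  set ε := fun n => eLpNorm (gradient (φ n) - weakGradient u) 2 volume
  have hε : ∀ n, ε n ≠ ⊤ := fun n => (((hφ n).1.memLp_gradient 2).sub hw).2.ne
  have hd : dNorm u ≠ ⊤ := hw.2.ne
  have hD : ∀ n, (eLpNorm (gradient (φ n)) 2 volume).toReal ≤ (dNorm u + ε n).toReal :=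
    fun n => by
      refine ENNReal.toReal_mono (ENNReal.add_ne_top.2 ⟨hd, hε n⟩) ?_
      have := eLpNorm_add_le hw.1 (((hφ n).1.memLp_gradient 2).sub hw).1 one_le_two
      rwa [add_sub_cancel] at this
  have hDt : Tendsto (fun n => (dNorm u + ε (ns n)).toReal) atTop (𝓝 (dNorm u).toReal) := by
    refine (ENNReal.tendsto_toReal hd).comp ?_
    simpa using (hφ2.comp hns.tendsto_atTop).const_add (dNorm u)
  have hsq : ∀ n, (eLpNorm (gradient (φ n)) 2 volume).toReal ^ 2 ≤ (dNorm u + ε n).toReal ^ 2 :=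
    fun n => pow_le_pow_left₀ ENNReal.toReal_nonneg (hD n) 2
  refine ⟨{x | x ≠ 0 ∧ Tendsto (fun i => φ (ns i) x) atTop (𝓝 (u x))}, ?_, fun x hx => hx.1,
    ⟨fun x hx => ?_, fun x hx y hy => ?_⟩⟩
  · filter_upwards [Measure.ae_ne (volume : Measure (Space N)) 0, hae] with x h0 h
    exact ⟨h0, h⟩
  · refine le_of_tendsto_of_tendsto' (hx.2.pow 2)
      (((hDt.pow 2).const_mul (radialConst N)).mul_const _) fun n => ?_
    refine ((hφ (ns n)).sq_le hN hx.1).trans ?_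
    exact mul_le_mul_of_nonneg_right (mul_le_mul_of_nonneg_left (hsq _) (radialConst_nonneg N))
      (radialGauge_pos hN (norm_pos_iff.2 hx.1)).le
  · refine le_of_tendsto_of_tendsto' ((hx.2.sub hy.2).pow 2)
      (((hDt.pow 2).const_mul (radialConst N)).mul_const _) fun n => ?_
    refine ((hφ (ns n)).sq_sub_le_abs hN hx.1 hy.1).trans ?_
    exact mul_le_mul_of_nonneg_right (mul_le_mul_of_nonneg_left (hsq _) (radialConst_nonneg N))
      (abs_nonneg _)

theorem ae_abs_le_of_mem_DSpace (hN : 3 ≤ N) (hu : u ∈ DSpace N) {a : ℝ} (ha : 0 < a) :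
    ∀ᵐ x, a ≤ ‖x‖ →
      |u x| ≤ Real.sqrt (radialConst N * radialGauge N a) * (dNorm u).toReal := by
  obtain ⟨S, hS, -, hest⟩ := exists_radialEstimate hN hu
  filter_upwards [hS] with x hx hax
  have h0 : 0 ≤ radialConst N * radialGauge N a :=
    mul_nonneg (radialConst_nonneg N) (radialGauge_pos hN ha).le
  refine abs_le_of_sq_le_sq ?_ (by positivity)
  rw [mul_pow, Real.sq_sqrt h0, mul_right_comm]
  exact (hest.sq_le x hx).trans (mul_le_mul_of_nonneg_left (radialGauge_anti hN ha hax)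
    (mul_nonneg (radialConst_nonneg N) (sq_nonneg _)))

theorem RadialEstimate.mono (hN : 3 ≤ N) {S T : Set (Space N)} {d M : ℝ}
    (h : RadialEstimate S d u) (hTS : T ⊆ S) (h0 : ∀ x ∈ T, x ≠ 0) (hd : 0 ≤ d) (hdM : d ≤ M) :
    RadialEstimate T M u := by
  have hc : radialConst N * d ^ 2 ≤ radialConst N * M ^ 2 :=
    mul_le_mul_of_nonneg_left (pow_le_pow_left₀ hd hdM 2) (radialConst_nonneg N)
  exact ⟨fun x hx => (h.sq_le x (hTS hx)).trans (mul_le_mul_of_nonneg_right hc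
      (radialGauge_pos hN (norm_pos_iff.2 (h0 x hx))).le),
    fun x hx y hy => (h.sq_sub_le x (hTS hx) y (hTS hy)).trans (mul_le_mul_of_nonneg_right hc
      (abs_nonneg _))⟩

/-- A sequence of functions with a common modulus of continuity on `S` that converges on a dense
subset of `S` is pointwise Cauchy on `S`. -/
theorem cauchySeq_of_radialEstimate (hN : 3 ≤ N) {S : Set (Space N)} (h0 : ∀ x ∈ S, x ≠ 0)
    {M : ℝ} {w : ℕ → Space N → ℝ} (hw : ∀ n, RadialEstimate S M (w n)) {D : Set S} (hD : Dense D)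
    (hc : ∀ y ∈ D, CauchySeq fun n => w n y) (x : S) : CauchySeq fun n => w n x := by
  rw [Metric.cauchySeq_iff]
  intro ε hε
  have hcont : ContinuousAt (fun y : S => radialConst N * M ^ 2 *
      |radialGauge N ‖(x : Space N)‖ - radialGauge N ‖(y : Space N)‖|) x := by
    have h1 : ContinuousAt (fun y : S => radialGauge N ‖(y : Space N)‖) x :=
      ContinuousAt.comp (g := radialGauge N) (f := fun y : S => ‖(y : Space N)‖)
        (continuousAt_radialGauge hN (norm_pos_iff.2 (h0 x x.2)))
        (Continuous.continuousAt (by fun_prop))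
    exact ((continuousAt_const.sub h1).abs).const_mul _
  have hev : ∀ᶠ y : S in 𝓝 x, radialConst N * M ^ 2 *
      |radialGauge N ‖(x : Space N)‖ - radialGauge N ‖(y : Space N)‖| < (ε / 3) ^ 2 := by
    refine hcont.eventually_lt_const ?_
    simp only [sub_self, abs_zero, mul_zero]
    positivity
  obtain ⟨y, hy, hyD⟩ := mem_closure_iff_nhds.1 (hD x) _ hev
  have hxy : ∀ n, |w n x - w n y| < ε / 3 := fun n =>
    abs_lt_of_sq_lt_sq (((hw n).sq_sub_le x x.2 y y.2).trans_lt hy) (by positivity)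
  obtain ⟨n₀, hn₀⟩ := Metric.cauchySeq_iff.1 (hc y hyD) (ε / 3) (by positivity)
  refine ⟨n₀, fun m hm n hn => ?_⟩
  have h1 := hn₀ m hm n hn
  rw [Real.dist_eq] at h1 ⊢
  have h2 := abs_lt.1 (hxy m)
  have h3 := abs_lt.1 (hxy n)
  have h4 := abs_lt.1 h1
  exact abs_lt.2 ⟨by linarith, by linarith⟩

theorem exists_subseq_tendsto_ae (hN : 3 ≤ N) {w : ℕ → Space N → ℝ} (hw : ∀ n, w n ∈ DSpace N)
    {M : ℝ≥0} (hM : ∀ n, dNorm (w n) ≤ M) :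
    ∃ (v : Space N → ℝ) (σ : ℕ → ℕ), StrictMono σ ∧
      ∀ᵐ x, Tendsto (fun n => w (σ n) x) atTop (𝓝 (v x)) := by
  choose T hT hT0 hTw using fun n => exists_radialEstimate hN (hw n)
  set S := ⋂ n, T n
  have hS : ∀ᵐ x, x ∈ S := by
    filter_upwards [ae_all_iff.2 hT] with x hx using mem_iInter.2 hx
  have hS0 : ∀ x ∈ S, x ≠ 0 := fun x hx => hT0 0 x (mem_iInter.1 hx 0)
  have hest : ∀ n, RadialEstimate S M (w n) := fun n =>
    (hTw n).mono hN (iInter_subset _ n) hS0 ENNReal.toReal_nonneg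
      (by simpa using ENNReal.toReal_mono ENNReal.coe_ne_top (hM n))
  obtain ⟨D, hDc, hD⟩ := TopologicalSpace.exists_countable_dense S
  have := hDc.to_subtype
  have hcomp : IsCompact (Set.pi univ fun y : D =>
      Icc (-Real.sqrt (radialConst N * M ^ 2 * radialGauge N ‖(y : Space N)‖))
        (Real.sqrt (radialConst N * M ^ 2 * radialGauge N ‖(y : Space N)‖))) :=
    isCompact_univ_pi fun y => isCompact_Icc
  obtain ⟨a, -, σ, hσ, ha⟩ := hcomp.tendsto_subseq (x := fun n (y : D) => w n y) fun n y _ =>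
    abs_le.1 (Real.abs_le_sqrt ((hest n).sq_le _ y.1.2))
  have hcauchy : ∀ x : S, CauchySeq fun n => w (σ n) x :=
    cauchySeq_of_radialEstimate hN hS0 (fun n => hest (σ n)) hD fun y hy =>
      ((tendsto_pi_nhds.1 ha) ⟨y, hy⟩).cauchySeq
  refine ⟨fun x => limUnder atTop fun n => w (σ n) x, σ, hσ, ?_⟩
  filter_upwards [hS] with x hx using (hcauchy ⟨x, hx⟩).tendsto_limUnder

end DSpace

/-! ### Auxiliary facts on `L^p` norms -/

section Lp

variable {α : Type*} [MeasurableSpace α] {μ : Measure α} {p : ℝ≥0∞}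

theorem eLpNorm_restrict_le_add {f : α → ℝ} (hf : AEStronglyMeasurable f μ) (hp : 1 ≤ p)
    {s a b : Set α} (ha : MeasurableSet a) (hs : s ⊆ a ∪ b) :
    eLpNorm f p (μ.restrict s) ≤ eLpNorm f p (μ.restrict a) + eLpNorm f p (μ.restrict b) := by
  have h1 : eLpNorm f p (μ.restrict s) ≤ eLpNorm (a.indicator f) p (μ.restrict s) +
      eLpNorm (aᶜ.indicator f) p (μ.restrict s) := by
    conv_lhs => rw [← indicator_self_add_compl a f]
    exact eLpNorm_add_le (hf.restrict.indicator ha) (hf.restrict.indicator ha.compl) hp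
  refine h1.trans (add_le_add ?_ ?_)
  · rw [eLpNorm_indicator_eq_eLpNorm_restrict ha, Measure.restrict_restrict ha]
    exact eLpNorm_mono_measure _ (Measure.restrict_mono inter_subset_left le_rfl)
  · rw [eLpNorm_indicator_eq_eLpNorm_restrict ha.compl, Measure.restrict_restrict ha.compl]
    exact eLpNorm_mono_measure _ (Measure.restrict_mono
      (fun x hx => (hs hx.2).resolve_left hx.1) le_rfl)

theorem eLpNorm_le_of_tendsto_ae {f : ℕ → α → ℝ} {v : α → ℝ}
    (hf : ∀ n, AEStronglyMeasurable (f n) μ)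
    (hv : ∀ᵐ x ∂μ, Tendsto (fun n => f n x) atTop (𝓝 (v x)))
    {c : ℝ≥0∞} (hc : ∀ n, eLpNorm (f n) p μ ≤ c) : eLpNorm v p μ ≤ c :=
  (Lp.eLpNorm_lim_le_liminf_eLpNorm hf v hv).trans
    (liminf_le_of_le (by isBoundedDefault) fun _ hb =>
      let ⟨n, hn⟩ := hb.exists
      hn.trans (hc n))

/-- Bounded convergence in `L^p` of a finite measure. -/
theorem tendsto_eLpNorm_sub_of_bound [IsFiniteMeasure μ] (hp0 : p ≠ 0) (hp : p ≠ ⊤)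
    {f : ℕ → α → ℝ} {v : α → ℝ} (hf : ∀ n, AEStronglyMeasurable (f n) μ) {C : ℝ}
    (hC : ∀ n, ∀ᵐ x ∂μ, |f n x| ≤ C)
    (hv : ∀ᵐ x ∂μ, Tendsto (fun n => f n x) atTop (𝓝 (v x))) :
    Tendsto (fun n => eLpNorm (f n - v) p μ) atTop (𝓝 0) := by
  have hvm : AEStronglyMeasurable v μ := aestronglyMeasurable_of_tendsto_ae atTop hf hv
  have hp' : 0 < p.toReal := ENNReal.toReal_pos hp0 hp
  simp only [eLpNorm_eq_lintegral_rpow_enorm_toReal hp0 hp]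
  have key : Tendsto (fun n => ∫⁻ x, ‖(f n - v) x‖ₑ ^ p.toReal ∂μ) atTop
      (𝓝 (∫⁻ _, 0 ∂μ)) := by
    refine tendsto_lintegral_of_dominated_convergence'
      (fun _ => ENNReal.ofReal (C + C) ^ p.toReal)
      (fun n => ((hf n).sub hvm).enorm.pow_const _) (fun n => ?_) ?_ ?_
    · filter_upwards [ae_all_iff.2 hC, hv] with x hx hvx
      have hvC : |v x| ≤ C := le_of_tendsto' hvx.abs hx
      refine ENNReal.rpow_le_rpow ?_ hp'.le
      rw [Pi.sub_apply, Real.enorm_eq_ofReal_abs]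
      exact ENNReal.ofReal_le_ofReal ((abs_sub _ _).trans (add_le_add (hx n) hvC))
    · rw [lintegral_const]
      exact ENNReal.mul_ne_top (ENNReal.rpow_ne_top_of_nonneg hp'.le ENNReal.ofReal_ne_top)
        (measure_ne_top _ _)
    · filter_upwards [hv] with x hx
      have h1 : Tendsto (fun n => ‖(f n - v) x‖ₑ) atTop (𝓝 0) := by
        have := (hx.sub_const (v x)).enorm
        simpa using this
      simpa [hp'] using h1.ennrpow_const p.toReal
  simpa [hp'] using key.ennrpow_const (1 / p.toReal)

/-- Convergence in `L^p(s)` of an almost everywhere convergent sequence that is uniformly small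
in `L^p(a)`, and bounded on a set `b` of finite measure with `s ⊆ a ∪ b`. -/
theorem tendsto_eLpNorm_sub_of_small_of_bound (hp1 : 1 ≤ p) (hp : p ≠ ⊤) {f : ℕ → α → ℝ}
    {v : α → ℝ} (hf : ∀ n, AEStronglyMeasurable (f n) μ)
    (hv : ∀ᵐ x ∂μ, Tendsto (fun n => f n x) atTop (𝓝 (v x))) {s : Set α}
    (h : ∀ ε : ℝ≥0∞, 0 < ε → ∃ a b : Set α, MeasurableSet a ∧ s ⊆ a ∪ b ∧
      (∀ n, eLpNorm (f n) p (μ.restrict a) ≤ ε) ∧ μ b < ⊤ ∧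
      ∃ C : ℝ, ∀ n, ∀ᵐ x ∂μ.restrict b, |f n x| ≤ C) :
    Tendsto (fun n => eLpNorm (f n - v) p (μ.restrict s)) atTop (𝓝 0) := by
  have hvm : AEStronglyMeasurable v μ := aestronglyMeasurable_of_tendsto_ae atTop hf hv
  rw [ENNReal.tendsto_nhds_zero]
  intro ε hε
  have hε3 : 0 < ε / 3 := ENNReal.div_pos hε.ne' (by simp)
  obtain ⟨a, b, ha, hs, hsmall, hb, C, hC⟩ := h (ε / 3) hε3
  have : IsFiniteMeasure (μ.restrict b) := ⟨by simpa using hb⟩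
  have hlim := tendsto_eLpNorm_sub_of_bound (one_pos.trans_le hp1).ne' hp
    (fun n => (hf n).restrict (s := b)) hC (ae_restrict_of_ae hv)
  filter_upwards [ENNReal.tendsto_nhds_zero.1 hlim _ hε3] with n hn
  have h1 : eLpNorm (f n - v) p (μ.restrict a) ≤ ε / 3 + ε / 3 :=
    (eLpNorm_sub_le (hf n).restrict hvm.restrict hp1).trans (add_le_add (hsmall n)
      (eLpNorm_le_of_tendsto_ae (fun n => (hf n).restrict) (ae_restrict_of_ae hv) hsmall))
  calc eLpNorm (f n - v) p (μ.restrict s)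
      ≤ eLpNorm (f n - v) p (μ.restrict a) + eLpNorm (f n - v) p (μ.restrict b) :=
        eLpNorm_restrict_le_add ((hf n).sub hvm) hp1 ha hs
    _ ≤ ε / 3 + ε / 3 + ε / 3 := add_le_add h1 hn
    _ = ε := ENNReal.add_thirds ε

end Lp

/-! ### Weighted `L^q` norms of functions in `E` -/

section Weighted

variable {N : ℕ} {V K : ℝ → ℝ} {q : ℝ} {u : Space N → ℝ}

theorem weightedMeasure_absolutelyContinuous : weightedMeasure N K ≪ volume :=
  withDensity_absolutelyContinuous _ _

theorem aemeasurable_weight (hN : 3 ≤ N) (hKc : ContinuousOn K (Ioi 0)) :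
    AEMeasurable (fun x : Space N => ENNReal.ofReal (K ‖x‖)) volume := by
  have := nontrivial_space hN
  have hc : ContinuousOn (fun x : Space N => K ‖x‖) {0}ᶜ :=
    hKc.comp continuous_norm.continuousOn fun x hx => norm_pos_iff.2 hx
  have h := hc.aemeasurable (μ := volume) (measurableSet_singleton 0).compl
  rw [Measure.restrict_eq_self_of_ae_mem] at h
  · exact h.ennreal_ofReal
  · exact Measure.ae_ne (volume : Measure (Space N)) 0

theorem setLIntegral_weight_eq (hN : 3 ≤ N) (hKc : ContinuousOn K (Ioi 0))
    (hK : ∀ r, 0 < r → 0 < K r) (hq : 0 < q) (hu : AEStronglyMeasurable u volume)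
    {s : Set (Space N)} (hs : MeasurableSet s) :
    ∫⁻ x in s, ENNReal.ofReal (K ‖x‖ * |u x| ^ q) =
      eLpNorm u (ENNReal.ofReal q) ((weightedMeasure N K).restrict s) ^ q := by
  have := nontrivial_space hN
  rw [eLpNorm_eq_lintegral_rpow_enorm_toReal (by simpa using hq) ENNReal.ofReal_ne_top,
    ENNReal.toReal_ofReal hq.le, ← ENNReal.rpow_mul, one_div_mul_cancel hq.ne',
    ENNReal.rpow_one, weightedMeasure, restrict_withDensity hs,
    lintegral_withDensity_eq_lintegral_mul₀ (aemeasurable_weight hN hKc).restrict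
      (hu.restrict.enorm.pow_const q)]
  refine lintegral_congr_ae (ae_restrict_of_ae ?_)
  filter_upwards [Measure.ae_ne (volume : Measure (Space N)) 0] with x hx
  rw [ENNReal.ofReal_mul (hK _ (norm_pos_iff.2 hx)).le, Pi.mul_apply, Real.enorm_eq_ofReal_abs,
    ENNReal.ofReal_rpow_of_nonneg (abs_nonneg _) hq.le]

theorem aestronglyMeasurable_of_mem_ESpace (hu : u ∈ ESpace N V) :
    AEStronglyMeasurable u volume := hu.1.1.1

theorem ae_eq_zero_of_dNorm_eq_zero (hN : 3 ≤ N) (hu : u ∈ DSpace N) (h : dNorm u = 0) :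
    u =ᵐ[volume] 0 := by
  obtain ⟨S, hS, -, hest⟩ := exists_radialEstimate hN hu
  filter_upwards [hS] with x hx
  have := hest.sq_le x hx
  rw [h] at this
  simpa using this

/-- The homogeneous form of the estimates defining `S₀` and `S_∞`. -/
theorem eLpNorm_le_iSup_mul_eNorm (hN : 3 ≤ N) (hV : ∀ r, 0 < r → 0 ≤ V r)
    (hKc : ContinuousOn K (Ioi 0)) (hK : ∀ r, 0 < r → 0 < K r) (hq : 0 < q)
    {s : Set (Space N)} (hs : MeasurableSet s) (hu : u ∈ ESpace N V) :
    eLpNorm u (ENNReal.ofReal q) ((weightedMeasure N K).restrict s) ≤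
      (⨆ u ∈ {u ∈ ESpace N V | eNorm V u = 1},
        ∫⁻ x in s, ENNReal.ofReal (K ‖x‖ * |u x| ^ q)) ^ q⁻¹ * eNorm V u := by
  have := nontrivial_space hN
  rcases eq_or_ne (eNorm V u) 0 with h0 | h0
  · have hd : dNorm u = 0 := le_antisymm ((dNorm_le_eNorm u).trans h0.le) zero_le
    rw [eLpNorm_congr_ae ((weightedMeasure_absolutelyContinuous.restrict s).ae_le
      (ae_restrict_of_ae (ae_eq_zero_of_dNorm_eq_zero hN hu.1 hd)))]
    simp
  have htop := (eNorm_lt_top hu).ne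
  have hc : 0 < (eNorm V u).toReal⁻¹ := inv_pos.2 (ENNReal.toReal_pos h0 htop)
  have hof : ENNReal.ofReal (eNorm V u).toReal⁻¹ = (eNorm V u)⁻¹ := by
    rw [ENNReal.ofReal_inv_of_pos (ENNReal.toReal_pos h0 htop), ENNReal.ofReal_toReal htop]
  set w := (eNorm V u).toReal⁻¹ • u with hw
  have hwE : w ∈ ESpace N V := const_smul_mem_ESpace hV hu hc
  have hw1 : eNorm V w = 1 := by
    rw [hw, eNorm_const_smul hu.1 hc, hof, ENNReal.inv_mul_cancel h0 htop]
  have hle := le_iSup₂ (f := fun u (_ : u ∈ {u ∈ ESpace N V | eNorm V u = 1}) =>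
    ∫⁻ x in s, ENNReal.ofReal (K ‖x‖ * |u x| ^ q)) w ⟨hwE, hw1⟩
  rw [setLIntegral_weight_eq hN hKc hK hq (aestronglyMeasurable_of_mem_ESpace hwE) hs,
    ← ENNReal.le_rpow_inv_iff hq, hw, eLpNorm_const_smul, Real.enorm_of_nonneg hc.le, hof] at hle
  rw [← ENNReal.div_le_iff h0 htop, div_eq_mul_inv, mul_comm]
  exact hle

/-- The closed annulus `a ≤ |x| ≤ b`. -/
def annulus (N : ℕ) (a b : ℝ) : Set (Space N) := {x | a ≤ ‖x‖ ∧ ‖x‖ ≤ b}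

theorem measurableSet_annulus (a b : ℝ) : MeasurableSet (annulus N a b) :=
  (measurableSet_le measurable_const measurable_norm).inter
    (measurableSet_le measurable_norm measurable_const)

theorem weightedMeasure_annulus_lt_top (hKc : ContinuousOn K (Ioi 0)) {a : ℝ} (ha : 0 < a)
    (b : ℝ) : weightedMeasure N K (annulus N a b) < ⊤ := by
  obtain ⟨C, hC⟩ := isCompact_Icc.exists_bound_of_continuousOn
    (hKc.mono fun x (hx : x ∈ Icc a b) => ha.trans_le hx.1)
  have hvol : volume (annulus N a b) < ⊤ := by
    refine (measure_mono fun x hx => ?_).trans_lt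
      (measure_closedBall_lt_top (x := (0 : Space N)) (r := b))
    simpa using hx.2
  rw [weightedMeasure, withDensity_apply _ (measurableSet_annulus a b)]
  refine (setLIntegral_mono' (measurableSet_annulus a b) (g := fun _ => ENNReal.ofReal C)
    fun x hx => ENNReal.ofReal_le_ofReal ((le_abs_self _).trans (hC _ hx))).trans_lt ?_
  rw [setLIntegral_const]
  exact ENNReal.mul_lt_top ENNReal.ofReal_lt_top hvol

theorem ae_restrict_annulus_abs_le (hN : 3 ≤ N) (hu : u ∈ DSpace N) {a : ℝ} (ha : 0 < a)
    (b : ℝ) : ∀ᵐ x ∂(weightedMeasure N K).restrict (annulus N a b),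
      |u x| ≤ Real.sqrt (radialConst N * radialGauge N a) * (dNorm u).toReal := by
  filter_upwards [ae_restrict_mem (measurableSet_annulus a b), ae_restrict_of_ae
    (weightedMeasure_absolutelyContinuous.ae_le (ae_abs_le_of_mem_DSpace hN hu ha))] with x hx h
  exact h hx.1

theorem exists_eLpNorm_annulus_le (hN : 3 ≤ N) (hKc : ContinuousOn K (Ioi 0)) (q : ℝ) {a : ℝ}
    (ha : 0 < a) (b : ℝ) : ∃ C : ℝ≥0∞, C < ⊤ ∧ ∀ u ∈ DSpace N,
      eLpNorm u (ENNReal.ofReal q) ((weightedMeasure N K).restrict (annulus N a b)) ≤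
        C * dNorm u := by
  refine ⟨weightedMeasure N K (annulus N a b) ^ (ENNReal.ofReal q).toReal⁻¹ *
    ENNReal.ofReal (Real.sqrt (radialConst N * radialGauge N a)),
    ENNReal.mul_lt_top (ENNReal.rpow_lt_top_of_nonneg (by positivity)
      (weightedMeasure_annulus_lt_top hKc ha b).ne) ENNReal.ofReal_lt_top, fun u hu => ?_⟩
  refine (eLpNorm_le_of_ae_bound (ae_restrict_annulus_abs_le hN hu ha b)).trans (le_of_eq ?_)
  rw [Measure.restrict_apply_univ, ENNReal.ofReal_mul (Real.sqrt_nonneg _),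
    ENNReal.ofReal_toReal (dNorm_lt_top hu).ne, mul_assoc]

end Weighted

/-! ### The sum space -/

section Sum

variable {N : ℕ} {V K : ℝ → ℝ} {q₁ q₂ : ℝ} {u : Space N → ℝ} {s : Set (Space N)}

theorem isDecomposition_indicator (hs : MeasurableSet s) (hu : AEStronglyMeasurable u volume)
    (h₁ : eLpNorm u (ENNReal.ofReal q₁) ((weightedMeasure N K).restrict s) < ⊤)
    (h₂ : eLpNorm u (ENNReal.ofReal q₂) ((weightedMeasure N K).restrict sᶜ) < ⊤) :
    IsDecomposition K q₁ q₂ u (s.indicator u) (sᶜ.indicator u) := by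
  have hu' := hu.mono_ac (weightedMeasure_absolutelyContinuous (K := K))
  refine ⟨⟨hu'.indicator hs, ?_⟩, ⟨hu'.indicator hs.compl, ?_⟩, ?_⟩
  · rwa [eLpNorm_indicator_eq_eLpNorm_restrict hs]
  · rwa [eLpNorm_indicator_eq_eLpNorm_restrict hs.compl]
  · rw [indicator_self_add_compl]

theorem sumNorm_le (hs : MeasurableSet s) (hu : AEStronglyMeasurable u volume) :
    sumNorm K q₁ q₂ u ≤
      max (eLpNorm u (ENNReal.ofReal q₁) ((weightedMeasure N K).restrict s))
        (eLpNorm u (ENNReal.ofReal q₂) ((weightedMeasure N K).restrict sᶜ)) := by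
  by_cases h : max (eLpNorm u (ENNReal.ofReal q₁) ((weightedMeasure N K).restrict s))
      (eLpNorm u (ENNReal.ofReal q₂) ((weightedMeasure N K).restrict sᶜ)) < ⊤
  · obtain ⟨h₁, h₂⟩ := max_lt_iff.1 h
    rw [← eLpNorm_indicator_eq_eLpNorm_restrict hs,
      ← eLpNorm_indicator_eq_eLpNorm_restrict hs.compl]
    exact iInf_le_of_le _ (iInf_le_of_le _
      (iInf_le _ (isDecomposition_indicator hs hu h₁ h₂)))
  · rw [not_lt_top_iff.1 h]
    exact le_top

theorem ball_subset_union_annulus (r R : ℝ) :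
    Metric.ball (0 : Space N) R ⊆ Metric.ball 0 r ∪ annulus N r R := fun x hx => by
  rcases lt_or_ge ‖x‖ r with h | h
  · exact Or.inl (by simpa using h)
  · exact Or.inr ⟨h, by simpa using (mem_ball_zero_iff.1 hx).le⟩

theorem compl_ball_subset_union_annulus (r R : ℝ) :
    (Metric.ball (0 : Space N) r)ᶜ ⊆ (Metric.ball 0 R)ᶜ ∪ annulus N r R := fun x hx => by
  rcases lt_or_ge ‖x‖ R with h | h
  · exact Or.inr ⟨by simpa using hx, h.le⟩
  · exact Or.inl (by simpa using h)

/-- An estimate on `a` extends to `s`, if `s` is covered by `a` and an annulus. -/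
theorem exists_eLpNorm_le_of_subset_union_annulus (hN : 3 ≤ N) (hV : ∀ r, 0 < r → 0 ≤ V r)
    (hKc : ContinuousOn K (Ioi 0)) (hK : ∀ r, 0 < r → 0 < K r) {q : ℝ} (hq : 1 < q)
    {s a : Set (Space N)} (ha : MeasurableSet a) {r R : ℝ} (hr : 0 < r)
    (hs : s ⊆ a ∪ annulus N r R)
    (hfin : (⨆ u ∈ {u ∈ ESpace N V | eNorm V u = 1},
      ∫⁻ x in a, ENNReal.ofReal (K ‖x‖ * |u x| ^ q)) < ⊤) :
    ∃ C : ℝ≥0∞, C < ⊤ ∧ ∀ u ∈ ESpace N V,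
      eLpNorm u (ENNReal.ofReal q) ((weightedMeasure N K).restrict s) ≤ C * eNorm V u := by
  obtain ⟨C, hC, h⟩ := exists_eLpNorm_annulus_le (N := N) hN hKc q hr R
  have hq0 : 0 < q := one_pos.trans hq
  refine ⟨_ + C, ENNReal.add_lt_top.2
    ⟨ENNReal.rpow_lt_top_of_nonneg (inv_nonneg.2 hq0.le) hfin.ne, hC⟩, fun u hu => ?_⟩
  rw [add_mul]
  refine (eLpNorm_restrict_le_add ((aestronglyMeasurable_of_mem_ESpace hu).mono_ac
    weightedMeasure_absolutelyContinuous) (ENNReal.one_le_ofReal.2 hq.le) ha hs).trans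
    (add_le_add (eLpNorm_le_iSup_mul_eNorm hN hV hKc hK hq0 ha hu) ((h u hu.1).trans ?_))
  gcongr
  exact dNorm_le_eNorm u

theorem exists_eLpNorm_ball_le (hN : 3 ≤ N) (hV : ∀ r, 0 < r → 0 ≤ V r)
    (hKc : ContinuousOn K (Ioi 0)) (hK : ∀ r, 0 < r → 0 < K r) {q R : ℝ} (hq : 1 < q)
    (hR : 0 < R) (hS : S0 N V K q R < ⊤) :
    ∃ C : ℝ≥0∞, C < ⊤ ∧ ∀ u ∈ ESpace N V, eLpNorm u (ENNReal.ofReal q)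
      ((weightedMeasure N K).restrict (Metric.ball 0 1)) ≤ C * eNorm V u :=
  exists_eLpNorm_le_of_subset_union_annulus hN hV hKc hK hq measurableSet_ball hR
    (ball_subset_union_annulus R 1) hS

theorem exists_eLpNorm_compl_ball_le (hN : 3 ≤ N) (hV : ∀ r, 0 < r → 0 ≤ V r)
    (hKc : ContinuousOn K (Ioi 0)) (hK : ∀ r, 0 < r → 0 < K r) {q R : ℝ} (hq : 1 < q)
    (hS : SInf N V K q R < ⊤) :
    ∃ C : ℝ≥0∞, C < ⊤ ∧ ∀ u ∈ ESpace N V, eLpNorm u (ENNReal.ofReal q)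
      ((weightedMeasure N K).restrict (Metric.ball 0 1)ᶜ) ≤ C * eNorm V u :=
  exists_eLpNorm_le_of_subset_union_annulus hN hV hKc hK hq measurableSet_ball.compl one_pos
    (compl_ball_subset_union_annulus 1 R) hS

theorem continuouslyEmbedded_of_S0_of_SInf (hN : 3 ≤ N) (hV : ∀ r, 0 < r → 0 ≤ V r)
    (hKc : ContinuousOn K (Ioi 0)) (hK : ∀ r, 0 < r → 0 < K r) (hq₁ : 1 < q₁) (hq₂ : 1 < q₂)
    {R₁ R₂ : ℝ} (hR₁ : 0 < R₁) (h₁ : S0 N V K q₁ R₁ < ⊤) (h₂ : SInf N V K q₂ R₂ < ⊤) :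
    ContinuouslyEmbedded (ESpace N V) (eNorm V) (SumSpace N K q₁ q₂) (sumNorm K q₁ q₂) := by
  obtain ⟨C₁, hC₁, hb₁⟩ := exists_eLpNorm_ball_le hN hV hKc hK hq₁ hR₁ h₁
  obtain ⟨C₂, hC₂, hb₂⟩ := exists_eLpNorm_compl_ball_le hN hV hKc hK hq₂ h₂
  refine ⟨fun u hu => ⟨_, _, isDecomposition_indicator (measurableSet_ball (x := 0) (ε := 1))
    (aestronglyMeasurable_of_mem_ESpace hu)
    ((hb₁ u hu).trans_lt (ENNReal.mul_lt_top hC₁ (eNorm_lt_top hu)))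
    ((hb₂ u hu).trans_lt (ENNReal.mul_lt_top hC₂ (eNorm_lt_top hu)))⟩,
    (max C₁ C₂).toNNReal, fun u hu => ?_⟩
  rw [ENNReal.coe_toNNReal (max_lt hC₁ hC₂).ne]
  refine (sumNorm_le measurableSet_ball (aestronglyMeasurable_of_mem_ESpace hu)).trans
    (max_le ((hb₁ u hu).trans ?_) ((hb₂ u hu).trans ?_))
  · gcongr
    exact le_max_left _ _
  · gcongr
    exact le_max_right _ _

/-- Convergence on `s` in the weighted `L^q` norm, if `s` is covered by annuli and sets `a i` on
which the suprema over the unit sphere of `E` tend to `0`. -/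
theorem tendsto_eLpNorm_sub_of_tendsto_iSup (hN : 3 ≤ N) (hV : ∀ r, 0 < r → 0 ≤ V r)
    (hKc : ContinuousOn K (Ioi 0)) (hK : ∀ r, 0 < r → 0 < K r) {q : ℝ} (hq : 1 < q)
    {s : Set (Space N)} {l : Filter ℝ} [l.NeBot] {a b : ℝ → Set (Space N)}
    (ha : ∀ R, MeasurableSet (a R)) (hsub : ∀ R, s ⊆ a R ∪ b R)
    (hb : ∀ᶠ R in l, ∃ r r' : ℝ, 0 < r ∧ b R = annulus N r r')
    (hlim : Tendsto (fun R => ⨆ u ∈ {u ∈ ESpace N V | eNorm V u = 1},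
      ∫⁻ x in a R, ENNReal.ofReal (K ‖x‖ * |u x| ^ q)) l (𝓝 0))
    {w : ℕ → Space N → ℝ} (hw : ∀ n, w n ∈ ESpace N V) {M : ℝ≥0} (hM : ∀ n, eNorm V (w n) ≤ M)
    {v : Space N → ℝ} (hv : ∀ᵐ x, Tendsto (fun n => w n x) atTop (𝓝 (v x))) :
    Tendsto (fun n => eLpNorm (w n - v) (ENNReal.ofReal q) ((weightedMeasure N K).restrict s))
      atTop (𝓝 0) := by
  have hq0 : 0 < q := one_pos.trans hq
  refine tendsto_eLpNorm_sub_of_small_of_bound (ENNReal.one_le_ofReal.2 hq.le)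
    ENNReal.ofReal_ne_top (fun n => (aestronglyMeasurable_of_mem_ESpace (hw n)).mono_ac
      weightedMeasure_absolutelyContinuous)
    (weightedMeasure_absolutelyContinuous.ae_le hv) fun ε hε => ?_
  have hlim' : Tendsto (fun R => (⨆ u ∈ {u ∈ ESpace N V | eNorm V u = 1},
      ∫⁻ x in a R, ENNReal.ofReal (K ‖x‖ * |u x| ^ q)) ^ q⁻¹ * (M : ℝ≥0∞)) l (𝓝 0) := by
    have h1 := hlim.ennrpow_const q⁻¹
    rw [ENNReal.zero_rpow_of_pos (inv_pos.2 hq0)] at h1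
    simpa using ENNReal.Tendsto.mul_const h1 (Or.inr (ENNReal.coe_ne_top (r := M)))
  obtain ⟨R, hR, r, r', hr, hbR⟩ := ((ENNReal.tendsto_nhds_zero.1 hlim' ε hε).and hb).exists
  refine ⟨a R, b R, ha R, hsub R, fun n => ?_, ?_, ?_⟩
  · refine ((eLpNorm_le_iSup_mul_eNorm hN hV hKc hK hq0 (ha R) (hw n)).trans ?_).trans hR
    gcongr
    exact hM n
  · rw [hbR]
    exact weightedMeasure_annulus_lt_top hKc hr r'
  · rw [hbR]
    refine ⟨Real.sqrt (radialConst N * radialGauge N r) * M, fun n => ?_⟩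
    filter_upwards [ae_restrict_annulus_abs_le (K := K) hN (hw n).1 hr r'] with x hx
    refine hx.trans (mul_le_mul_of_nonneg_left ?_ (Real.sqrt_nonneg _))
    simpa using ENNReal.toReal_mono ENNReal.coe_ne_top ((dNorm_le_eNorm _).trans (hM n))

theorem compactlyEmbedded_of_tendsto (hN : 3 ≤ N) (hV : ∀ r, 0 < r → 0 ≤ V r)
    (hKc : ContinuousOn K (Ioi 0)) (hK : ∀ r, 0 < r → 0 < K r) (hq₁ : 1 < q₁) (hq₂ : 1 < q₂)
    (h₁ : Tendsto (fun R => S0 N V K q₁ R) (𝓝[>] 0) (𝓝 0))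
    (h₂ : Tendsto (fun R => SInf N V K q₂ R) atTop (𝓝 0)) :
    CompactlyEmbedded (ESpace N V) (eNorm V) (SumSpace N K q₁ q₂) (sumNorm K q₁ q₂) := by
  obtain ⟨R₁, hS₁, hR₁⟩ := ((h₁.eventually_lt_const ENNReal.zero_lt_top).and
    self_mem_nhdsWithin).exists
  obtain ⟨R₂, hS₂⟩ := (h₂.eventually_lt_const ENNReal.zero_lt_top).exists
  obtain ⟨C₁, hC₁, hb₁⟩ := exists_eLpNorm_ball_le hN hV hKc hK hq₁ hR₁ hS₁
  obtain ⟨C₂, hC₂, hb₂⟩ := exists_eLpNorm_compl_ball_le hN hV hKc hK hq₂ hS₂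
  refine ⟨continuouslyEmbedded_of_S0_of_SInf hN hV hKc hK hq₁ hq₂ hR₁ hS₁ hS₂,
    fun u hu ⟨M, hM⟩ => ?_⟩
  obtain ⟨v, σ, hσ, hv⟩ := exists_subseq_tendsto_ae hN (fun n => (hu n).1)
    fun n => (dNorm_le_eNorm _).trans (hM n)
  have hum : ∀ n, AEStronglyMeasurable (u (σ n)) volume := fun n =>
    aestronglyMeasurable_of_mem_ESpace (hu _)
  have hvm : AEStronglyMeasurable v volume := aestronglyMeasurable_of_tendsto_ae atTop hum hv
  have hfatou : ∀ {q : ℝ} {s : Set (Space N)} {C : ℝ≥0∞}, C < ⊤ → (∀ u ∈ ESpace N V,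
      eLpNorm u (ENNReal.ofReal q) ((weightedMeasure N K).restrict s) ≤ C * eNorm V u) →
      eLpNorm v (ENNReal.ofReal q) ((weightedMeasure N K).restrict s) < ⊤ := fun hC hb => by
    refine (eLpNorm_le_of_tendsto_ae (fun n => ((hum n).mono_ac
      weightedMeasure_absolutelyContinuous).restrict)
      (ae_restrict_of_ae (weightedMeasure_absolutelyContinuous.ae_le hv))
      fun n => (hb _ (hu _)).trans (mul_le_mul_right (hM _) _)).trans_lt ?_
    exact ENNReal.mul_lt_top hC ENNReal.coe_lt_top
  refine ⟨v, ⟨_, _, isDecomposition_indicator (measurableSet_ball (x := 0) (ε := 1)) hvm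
    (hfatou hC₁ hb₁) (hfatou hC₂ hb₂)⟩, σ, hσ, ?_⟩
  have t₁ := tendsto_eLpNorm_sub_of_tendsto_iSup hN hV hKc hK hq₁
    (fun _ => measurableSet_ball) (fun R => ball_subset_union_annulus R 1)
    (by filter_upwards [self_mem_nhdsWithin] with R hR using ⟨R, 1, hR, rfl⟩)
    h₁ (fun n => hu (σ n)) (fun n => hM (σ n)) hv
  have t₂ := tendsto_eLpNorm_sub_of_tendsto_iSup hN hV hKc hK hq₂
    (fun _ => measurableSet_ball.compl) (fun R => compl_ball_subset_union_annulus 1 R)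
    (Eventually.of_forall fun R => ⟨1, R, one_pos, rfl⟩)
    h₂ (fun n => hu (σ n)) (fun n => hM (σ n)) hv
  have t := t₁.max t₂
  rw [max_self] at t
  exact tendsto_of_tendsto_of_tendsto_of_le_of_le tendsto_const_nhds t (fun _ => zero_le)
    fun n => sumNorm_le measurableSet_ball ((hum n).sub hvm)

end Sum

end QuasilinearSchrodinger

theorem theorem3p1 (N : ℕ) (hN : 3 ≤ N) (V K : ℝ → ℝ)
    (hVc : ContinuousOn V (Set.Ioi 0)) (hV : ∀ r, 0 < r → 0 ≤ V r)
    (hKc : ContinuousOn K (Set.Ioi 0)) (hK : ∀ r, 0 < r → 0 < K r)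
    (hVb : ∃ C : ℝ, 0 < C ∧ ∀ r, 0 < r → r < 1 → V r ≤ C / r ^ 2)
    (q₁ q₂ : ℝ) (hq₁ : 1 < q₁) (hq₂ : 1 < q₂) :
    ((∃ R₁ R₂ : ℝ, 0 < R₁ ∧ 0 < R₂ ∧
        QuasilinearSchrodinger.S0 N V K q₁ R₁ < ⊤ ∧
        QuasilinearSchrodinger.SInf N V K q₂ R₂ < ⊤) →
      QuasilinearSchrodinger.ContinuouslyEmbedded
        (QuasilinearSchrodinger.ESpace N V) (QuasilinearSchrodinger.eNorm V)
        (QuasilinearSchrodinger.SumSpace N K q₁ q₂)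
        (QuasilinearSchrodinger.sumNorm K q₁ q₂)) ∧
    ((Tendsto (fun R : ℝ => QuasilinearSchrodinger.S0 N V K q₁ R) (𝓝[>] 0) (𝓝 0) ∧
        Tendsto (fun R : ℝ => QuasilinearSchrodinger.SInf N V K q₂ R) atTop (𝓝 0)) →
      QuasilinearSchrodinger.CompactlyEmbedded
        (QuasilinearSchrodinger.ESpace N V) (QuasilinearSchrodinger.eNorm V)
        (QuasilinearSchrodinger.SumSpace N K q₁ q₂)
        (QuasilinearSchrodinger.sumNorm K q₁ q₂)) := by
  refine ⟨fun ⟨R₁, R₂, hR₁, _, h₁, h₂⟩ => ?_, fun ⟨h₁, h₂⟩ => ?_⟩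
  · exact QuasilinearSchrodinger.continuouslyEmbedded_of_S0_of_SInf hN hV hKc hK hq₁ hq₂ hR₁ h₁ h₂
  · exact QuasilinearSchrodinger.compactlyEmbedded_of_tendsto hN hV hKc hK hq₁ hq₂ h₁ h₂
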